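/- Let $S$ be a compact Polish space, $P(S)$ the set of Borel probability measures on $S$, $f:S\to\mathbb R$ and $c:S\times S\to[0,\infty)$ lower semicontinuous, $\mu\in P(S)$ and $r>0$. Let $X$ be the set of Borel probability measures $\pi$ on $S\times S$ with first marginal $\mu$ (and arbitrary second marginal), and for $\nu\in P(S)$ let $$d_c(\mu,\nu)=\inf\Big\{\int_{S\times S} c\,d\pi:\ \pi\text{ has marginals }\mu\text{ and }\nu\Big\}.$$ For $\lambda\ge 0$ put $\phi_\lambda(x)=\inf_{y\in S}\{f(y)+\lambda c(x,y)\}$ and, for $\pi\in X$, $$L(\pi,\lambda)=\int_{S\times S}\big(f(y)+\lambda c(x,y)\big)\,d\pi(x,y)-\lambda r.$$ All integrands are bounded below, integrals take values in $(-\infty,+\infty]$, and $\inf\emptyset=+\infty$. Then: 1. The following equalities hold in the extended reals: $$\inf_{\nu\in P(S),\ d_c(\mu,\nu)\le r}\int_S f\,d\nu\;=\;\inf_{\pi\in X,\ \int c\,d\pi\le r}\int_{S\times S} f(y)\,d\pi(x,y)\;=\;\sup_{\lambda\ge 0}\Big\{\int_S\phi_\lambda\,d\mu-\lambda r\Big\}.$$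 2. For all $\lambda\ge0$ and $x\in S$ the infimum defining $\phi_\lambda(x)$ is a minimum. 3. For every $\lambda\ge 0$ there is a Borel map $T:S\to S$ with $T(x)\in\arg\min_{y\in S}\{f(y)+\lambda c(x,y)\}$ for all $x\in S$; and for every such $T$ the deterministic coupling $\pi^*=(\mathrm{Id},T)_\#\mu$ belongs to $X$ and satisfies $$L(\pi^*,\lambda)=\min_{\pi\in X}L(\pi,\lambda)=\int_S\phi_\lambda\,d\mu-\lambda r.$$ -/

import Mathlib

open MeasureTheory
open scoped NNReal ENNReal

noncomputable section

namespace OTDuality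

/-- The integral of a real function with values in the extended reals, `∫ g⁺ dm - ∫ g⁻ dm`.
It is the usual (quasi-)integral whenever `∫ g⁻ dm < ∞`; in particular it is meaningful, with a
value in `(-∞, +∞]`, for measurable functions that are bounded below and `m` finite. -/
def extInt {X : Type*} [MeasurableSpace X] (m : Measure X) (g : X → ℝ) : EReal :=
  ((∫⁻ x, ENNReal.ofReal (g x) ∂m : ℝ≥0∞) : EReal)
    - ((∫⁻ x, ENNReal.ofReal (-g x) ∂m : ℝ≥0∞) : EReal)

/-- `Π(P, Q)`: the transport plans (couplings) from some measure in `P` to some measure in `Q`. -/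
def transportPlans {X Y : Type*} [MeasurableSpace X] [MeasurableSpace Y]
    (P : Set (ProbabilityMeasure X)) (Q : Set (ProbabilityMeasure Y)) :
    Set (ProbabilityMeasure (X × Y)) :=
  {π | π.map measurable_fst.aemeasurable ∈ P ∧ π.map measurable_snd.aemeasurable ∈ Q}

variable {S : Type*} [MeasurableSpace S]

/-- Total cost `∫ c dπ` of a plan, possibly infinite. -/
def planCost (c : S × S → ℝ≥0) (π : ProbabilityMeasure (S × S)) : ℝ≥0∞ :=
  ∫⁻ p, (c p : ℝ≥0∞) ∂(π : Measure (S × S))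

/-- The optimal transport cost `d_c(μ, ν)`. -/
def transportCost (c : S × S → ℝ≥0) (μ ν : ProbabilityMeasure S) : ℝ≥0∞ :=
  ⨅ π ∈ transportPlans {μ} {ν}, planCost c π

/-- The uncertainty set `B_r(μ)`. -/
def uncertaintySet (c : S × S → ℝ≥0) (μ : ProbabilityMeasure S) (r : ℝ) :
    Set (ProbabilityMeasure S) :=
  {ν | transportCost c μ ν ≤ ENNReal.ofReal r}

/-- All transport plans with first marginal `μ` and arbitrary second marginal. -/
def plansFrom (μ : ProbabilityMeasure S) : Set (ProbabilityMeasure (S × S)) :=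
  transportPlans {μ} Set.univ

/-- The primal value: infimum of `E_ν f` over `ν ∈ B_r(μ)` (`+∞` if there is no such `ν`). -/
def primalValue (f : S → ℝ) (c : S × S → ℝ≥0) (μ : ProbabilityMeasure S) (r : ℝ) : EReal :=
  ⨅ ν ∈ uncertaintySet c μ r, extInt (ν : Measure S) f

/-- The primal value over transport plans: infimum of `∫ f(y) dπ(x,y)` over the plans `π` from `μ`
with `∫ c dπ ≤ r`. -/
def primalPlanValue (f : S → ℝ) (c : S × S → ℝ≥0) (μ : ProbabilityMeasure S) (r : ℝ) : EReal :=
  ⨅ π ∈ {π ∈ plansFrom μ | planCost c π ≤ ENNReal.ofReal r},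
    extInt (π : Measure (S × S)) (fun p => f p.2)

/-- The Lagrangian `L(π, l) = ∫ (f(y) + l c(x,y)) dπ(x,y) - l r`. -/
def lagrangian (f : S → ℝ) (c : S × S → ℝ≥0) (r : ℝ) (π : ProbabilityMeasure (S × S))
    (l : ℝ≥0) : EReal :=
  extInt (π : Measure (S × S)) (fun p => f p.2 + l * c p) - ((l * r : ℝ) : EReal)

/-- `φ_l(x) = inf_y {f(y) + l c(x,y)}`. -/
def phi {S : Type*} (f : S → ℝ) (c : S × S → ℝ≥0) (l : ℝ≥0) (x : S) : ℝ :=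
  ⨅ y, (f y + l * c (x, y))

/-- The dual value `sup_{l ≥ 0} {∫ φ_l dμ - l r}`. -/
def dualValue (f : S → ℝ) (c : S × S → ℝ≥0) (μ : ProbabilityMeasure S) (r : ℝ) : EReal :=
  ⨆ l : ℝ≥0, (extInt (μ : Measure S) (phi f c l) - ((l * r : ℝ) : EReal))

/-- `T` selects, for every `x`, a minimiser of `y ↦ f(y) + l c(x,y)`. -/
def IsMinimiserSelection {S : Type*} (f : S → ℝ) (c : S × S → ℝ≥0) (l : ℝ≥0) (T : S → S) : Prop :=
  ∀ x y, f (T x) + l * c (x, T x) ≤ f y + l * c (x, y)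

/-- The deterministic coupling `(Id, T)_# μ`. -/
def deterministicPlan (μ : ProbabilityMeasure S) (T : S → S) (hT : Measurable T) :
    ProbabilityMeasure (S × S) :=
  μ.map (f := fun x => (x, T x)) (measurable_id.prodMk hT).aemeasurable

end OTDuality

end

/-! For a compact `S` the plans from `μ` form a compact set on which the total cost and the
objective are lower semicontinuous, so optimal couplings exist and the constraint on `ν` can be
moved to the plans. The pairs (cost, objective) of the plans from `μ` generate a closed convex
subset of the plane, because mixtures of plans are plans. If `a` is below the primal value, this
set misses the point `(r, a)`, and a line separating the two is a Lagrange multiplier `l` with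
`a ≤ L(π, l)` for every plan `π` from `μ`. Finally `L(·, l)` is minimised pointwise, by sending `x`
to a minimiser of `f(y) + l c(x, y)`; the set of these minimisers is compact and depends measurably
on `x`, which allows a Borel choice.
-/

namespace OTDuality

open Filter Topology

/-! ### Minimisation over a compact space -/

section Minimisation

variable {X Y β : Type*} [TopologicalSpace Y] [CompactSpace Y]

lemma isLeast_iInf_of_lowerSemicontinuous [Nonempty Y] [ConditionallyCompleteLinearOrder β]
    {u : Y → β} (hu : LowerSemicontinuous u) : IsLeast (Set.range u) (⨅ y, u y) := by
  obtain ⟨y, -, hy⟩ := (hu.lowerSemicontinuousOn Set.univ).exists_isMinOn Set.univ_nonempty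
    isCompact_univ
  have hleast : IsLeast (Set.range u) (u y) :=
    ⟨⟨y, rfl⟩, Set.forall_mem_range.2 fun z => hy (Set.mem_univ z)⟩
  rwa [iInf, hleast.csInf_eq]

lemma lowerSemicontinuous_iInf_snd [Nonempty Y] [TopologicalSpace X]
    [ConditionallyCompleteLinearOrder β] {h : X × Y → β} (hh : LowerSemicontinuous h) :
    LowerSemicontinuous fun x => ⨅ y, h (x, y) := by
  rw [lowerSemicontinuous_iff_isClosed_preimage]
  intro b
  convert isClosedMap_fst_of_compactSpace _ (hh.isClosed_preimage b)
  ext x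
  have hleast := isLeast_iInf_of_lowerSemicontinuous (hh.comp (Continuous.prodMk_right x))
  constructor
  · intro hb
    obtain ⟨y, hy⟩ := hleast.1
    exact ⟨(x, y), hy.trans_le hb, rfl⟩
  · rintro ⟨⟨x, y⟩, hb, rfl⟩
    exact (hleast.2 ⟨y, rfl⟩).trans hb

lemma measurableSet_argmin_inter_nonempty [TopologicalSpace X] [MeasurableSpace X]
    [OpensMeasurableSpace X] {h : X × Y → ℝ} (hh : LowerSemicontinuous h) {F : Set Y}
    (hF : IsClosed F) :
    MeasurableSet {x | ({y | ∀ z, h (x, y) ≤ h (x, z)} ∩ F).Nonempty} := by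
  rcases F.eq_empty_or_nonempty with rfl | hne
  · simp
  have : Nonempty Y := hne.to_type
  have : Nonempty F := hne.to_subtype
  have : CompactSpace F := isCompact_iff_compactSpace.1 hF.isCompact
  have hhF : LowerSemicontinuous fun p : X × F => h (p.1, p.2) :=
    hh.comp (continuous_fst.prodMk (continuous_subtype_val.comp continuous_snd))
  convert measurableSet_le (lowerSemicontinuous_iInf_snd hhF).measurable
    (lowerSemicontinuous_iInf_snd hh).measurable using 1
  ext x
  have hleast := isLeast_iInf_of_lowerSemicontinuous (hh.comp (Continuous.prodMk_right x))
  have hleastF := isLeast_iInf_of_lowerSemicontinuous (hhF.comp (Continuous.prodMk_right x))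
  constructor
  · rintro ⟨y, hy, hyF⟩
    obtain ⟨z, hz⟩ := hleast.1
    exact (hleastF.2 ⟨⟨y, hyF⟩, rfl⟩).trans ((hy z).trans_eq hz)
  · intro hle
    obtain ⟨y, hy⟩ := hleastF.1
    exact ⟨y, fun z => (hy.trans_le hle).trans (hleast.2 ⟨z, rfl⟩), y.2⟩

-- `Y` is a continuous image of the Cantor set by the Hausdorff–Alexandroff theorem, and the
-- least point of the Cantor set lying over `A x` depends measurably on `x`.
theorem exists_measurable_selection [MeasurableSpace X] [TopologicalSpace.MetrizableSpace Y]
    [MeasurableSpace Y] [BorelSpace Y] {A : X → Set Y} (hclosed : ∀ x, IsClosed (A x))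
    (hne : ∀ x, (A x).Nonempty)
    (hmeas : ∀ F, IsClosed F → MeasurableSet {x | (A x ∩ F).Nonempty}) :
    ∃ T : X → Y, Measurable T ∧ ∀ x, T x ∈ A x := by
  let _ : MetricSpace Y := TopologicalSpace.metrizableSpaceMetric Y
  rcases isEmpty_or_nonempty X with hX | ⟨⟨x₀⟩⟩
  · exact ⟨isEmptyElim, measurable_of_empty _, isEmptyElim⟩
  have : Nonempty Y := ⟨(hne x₀).some⟩
  have : CompactSpace cantorSet := isCompact_iff_compactSpace.1 isCompact_cantorSet
  obtain ⟨p, hp, hpsurj⟩ := exists_nat_bool_continuous_surjective_of_compact Y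
  let g : cantorSet → Y := p ∘ cantorSetHomeomorphNatToBool
  have hg : Continuous g := hp.comp cantorSetHomeomorphNatToBool.continuous
  have hgsurj : Function.Surjective g := hpsurj.comp cantorSetHomeomorphNatToBool.surjective
  have hleast (x : X) : ∃ k, IsLeast (g ⁻¹' A x) k :=
    ((hclosed x).preimage hg).isCompact.exists_isLeast ((hne x).preimage hgsurj)
  choose s hs using hleast
  have hsmeas : Measurable fun x => (s x : ℝ) := by
    refine measurable_of_Iic fun t => ?_
    have hF : IsClosed (g '' {k | (k : ℝ) ≤ t}) :=
      hg.isClosedMap _ (isClosed_le continuous_subtype_val continuous_const)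
    convert hmeas _ hF using 1
    ext x
    constructor
    · exact fun hx => ⟨g (s x), (hs x).1, s x, hx, rfl⟩
    · rintro ⟨-, hk, k, hkt, rfl⟩
      exact (Subtype.coe_le_coe.2 ((hs x).2 hk)).trans hkt
  exact ⟨g ∘ s, hg.measurable.comp hsmeas.subtype_mk, fun x => (hs x).1⟩

theorem exists_measurable_forall_le [TopologicalSpace.MetrizableSpace Y] [MeasurableSpace Y]
    [BorelSpace Y] [Nonempty Y] [TopologicalSpace X] [MeasurableSpace X] [OpensMeasurableSpace X]
    {h : X × Y → ℝ} (hh : LowerSemicontinuous h) :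
    ∃ T : X → Y, Measurable T ∧ ∀ x y, h (x, T x) ≤ h (x, y) := by
  have hlsc (x : X) : LowerSemicontinuous fun y => h (x, y) :=
    hh.comp (Continuous.prodMk_right x)
  refine exists_measurable_selection (A := fun x => {y | ∀ z, h (x, y) ≤ h (x, z)})
    (fun x => ?_) (fun x => ?_) fun F hF => measurableSet_argmin_inter_nonempty hh hF
  · simp only [Set.ofPred_forall]
    exact isClosed_iInter fun z => (hlsc x).isClosed_preimage (h (x, z))
  · obtain ⟨⟨y, hy⟩, hmin⟩ := isLeast_iInf_of_lowerSemicontinuous (hlsc x)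
    exact ⟨y, fun z => hy.trans_le (hmin ⟨z, rfl⟩)⟩

lemma exists_coe_eq_add [TopologicalSpace X] {f : X → ℝ} (hf : LowerSemicontinuous f)
    (hf_bdd : BddBelow (Set.range f)) (a : ℝ) :
    ∃ B : ℝ≥0, -a ≤ B ∧ ∃ g : X → ℝ≥0, LowerSemicontinuous g ∧ ∀ x, (g x : ℝ) = f x + B := by
  obtain ⟨b, hb⟩ := hf_bdd
  have hB := Real.le_coe_toNNReal (max (-a) (-b))
  refine ⟨_, (le_max_left _ _).trans hB, fun x => Real.toNNReal (f x + _),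
    continuous_real_toNNReal.comp_lowerSemicontinuous (hf.add continuous_const.lowerSemicontinuous)
      (fun _ _ => Real.toNNReal_mono), fun x => Real.coe_toNNReal _ ?_⟩
  linarith [hb ⟨x, rfl⟩, (le_max_right _ _).trans hB]

end Minimisation

/-! ### Lagrange multipliers -/

section Multiplier

lemma map_nonneg_of_isUpperSet {E : Type*} [AddCommGroup E] [PartialOrder E]
    [IsOrderedAddMonoid E] [Module ℝ E] {D : Set E} (hD : IsUpperSet D) (hne : D.Nonempty)
    {F : E →ₗ[ℝ] ℝ} {u : ℝ} (hF : ∀ p ∈ D, u ≤ F p) {v : E} (hv : 0 ≤ v) : 0 ≤ F v := by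
  obtain ⟨p, hp⟩ := hne
  by_contra! hneg
  obtain ⟨n, hn⟩ := Archimedean.arch (F p - u + 1) (neg_pos.2 hneg)
  have hu := hF (p + n • v) (hD (le_add_of_nonneg_right (nsmul_nonneg hv n)) hp)
  rw [map_add, map_nsmul] at hu
  rw [smul_neg] at hn
  linarith

lemma exists_pos_slope_of_notMem {D : Set (ℝ × ℝ)} (hconv : Convex ℝ D) (hclosed : IsClosed D)
    (hpos : D ⊆ Set.Ici 0) (hup : IsUpperSet D) {r a : ℝ} (hra : (r, a) ∉ D) :
    ∃ l : ℝ, 0 < l ∧ ∀ p ∈ D, a + l * r ≤ p.2 + l * p.1 := by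
  rcases D.eq_empty_or_nonempty with rfl | hne
  · exact ⟨1, one_pos, by simp⟩
  obtain ⟨F, u, hu, hF⟩ := geometric_hahn_banach_point_closed hconv hclosed hra
  have hF_apply (p : ℝ × ℝ) : F p = F (1, 0) * p.1 + F (0, 1) * p.2 := by
    have : p = p.1 • ((1, 0) : ℝ × ℝ) + p.2 • ((0, 1) : ℝ × ℝ) := by ext <;> simp
    conv_lhs => rw [this, map_add, map_smul, map_smul, smul_eq_mul, smul_eq_mul]
    ring
  have hF_nonneg {v : ℝ × ℝ} (hv : 0 ≤ v) : 0 ≤ F v :=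
    map_nonneg_of_isUpperSet (F := (F : ℝ × ℝ →ₗ[ℝ] ℝ)) hup hne (fun p hp => (hF p hp).le) hv
  have hα : 0 ≤ F (1, 0) := hF_nonneg ⟨zero_le_one, le_rfl⟩
  have hβ : 0 ≤ F (0, 1) := hF_nonneg ⟨le_rfl, zero_le_one⟩
  -- The separating line may be vertical; the gap `u - F (r, a)` leaves room to add a small
  -- `ε` to both of its coefficients.
  obtain ⟨ε, hε, hε_le⟩ : ∃ ε : ℝ, 0 < ε ∧ ε * (r + a) ≤ u - F (r, a) := by
    have hgap := sub_pos.2 hu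
    refine ⟨(u - F (r, a)) / (|r| + |a| + 1), by positivity, ?_⟩
    rw [div_mul_eq_mul_div, div_le_iff₀ (by positivity)]
    exact mul_le_mul_of_nonneg_left (by linarith [le_abs_self r, le_abs_self a]) hgap.le
  refine ⟨(F (1, 0) + ε) / (F (0, 1) + ε), by positivity, fun p hp => ?_⟩
  have hp_pos : 0 ≤ ε * (p.1 + p.2) := mul_nonneg hε.le (add_nonneg (hpos hp).1 (hpos hp).2)
  have hsep : (F (0, 1) + ε) * a + (F (1, 0) + ε) * r ≤
      (F (0, 1) + ε) * p.2 + (F (1, 0) + ε) * p.1 := by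
    have hFp := hF p hp
    rw [hF_apply] at hFp hε_le
    linarith
  have hβε : 0 < F (0, 1) + ε := by positivity
  refine le_of_mul_le_mul_left ?_ hβε
  rw [mul_add, mul_add, div_mul_eq_mul_div, div_mul_eq_mul_div, mul_div_cancel₀ _ hβε.ne',
    mul_div_cancel₀ _ hβε.ne']
  exact hsep

variable {P : Type*}

/-- The pair `(C, G)` is *convexlike* in the sense of Fan: any convex combination of two of its
values dominates a third one. This replaces convexity of `C` and `G` on domains, such as a
space of probability measures, that do not carry a linear structure. -/
def IsConvexlike (C G : P → ℝ≥0∞) : Prop :=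
  ∀ x y, ∀ s t : ℝ≥0, s + t = 1 → ∃ z, C z ≤ s * C x + t * C y ∧ G z ≤ s * G x + t * G y

/-- The upper image of `(C, G)`: the points of the closed quadrant that dominate some value
`(C x, G x)`. Minimising `G` under the constraint `C ≤ r` amounts to finding the lowest point of
this set with abscissa `r`. -/
def upperImage (C G : P → ℝ≥0∞) : Set (ℝ × ℝ) :=
  {p | 0 ≤ p ∧ ∃ x, C x ≤ ENNReal.ofReal p.1 ∧ G x ≤ ENNReal.ofReal p.2}

lemma isUpperSet_upperImage (C G : P → ℝ≥0∞) : IsUpperSet (upperImage C G) := by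
  rintro p q hpq ⟨hp, x, hC, hG⟩
  exact ⟨hp.trans hpq, x, hC.trans (ENNReal.ofReal_le_ofReal hpq.1),
    hG.trans (ENNReal.ofReal_le_ofReal hpq.2)⟩

lemma isClosed_upperImage [TopologicalSpace P] [CompactSpace P] {C G : P → ℝ≥0∞}
    (hC : LowerSemicontinuous C) (hG : LowerSemicontinuous G) : IsClosed (upperImage C G) := by
  have hepi {H : P → ℝ≥0∞} (hH : LowerSemicontinuous H) {φ : ℝ × ℝ → ℝ} (hφ : Continuous φ) :
      IsClosed {q : P × (ℝ × ℝ) | H q.1 ≤ ENNReal.ofReal (φ q.2)} :=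
    hH.isClosed_epigraph.preimage
      (continuous_fst.prodMk (ENNReal.continuous_ofReal.comp (hφ.comp continuous_snd)))
  convert (isClosed_Ici (a := (0 : ℝ × ℝ))).inter (isClosedMap_snd_of_compactSpace _
    ((hepi hC continuous_fst).inter (hepi hG continuous_snd))) using 1
  ext p
  simp [upperImage]

lemma convex_upperImage {C G : P → ℝ≥0∞} (h : IsConvexlike C G) :
    Convex ℝ (upperImage C G) := by
  rintro p ⟨hp, x, hxC, hxG⟩ q ⟨hq, y, hyC, hyG⟩ s t hs ht hst
  lift s to ℝ≥0 using hs
  lift t to ℝ≥0 using ht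
  obtain ⟨z, hzC, hzG⟩ := h x y s t (by exact_mod_cast hst)
  have hcomb {v w : ℝ} (hv : 0 ≤ v) (hw : 0 ≤ w) :
      (s * ENNReal.ofReal v + t * ENNReal.ofReal w : ℝ≥0∞) = ENNReal.ofReal (s * v + t * w) := by
    rw [ENNReal.ofReal_add (by positivity) (by positivity), ENNReal.ofReal_mul (by positivity),
      ENNReal.ofReal_mul (by positivity), ENNReal.ofReal_coe_nnreal, ENNReal.ofReal_coe_nnreal]
  refine ⟨add_nonneg (smul_nonneg s.2 hp) (smul_nonneg t.2 hq), z, hzC.trans ?_, hzG.trans ?_⟩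
  · exact (add_le_add (mul_le_mul_right hxC _) (mul_le_mul_right hyC _)).trans_eq
      (hcomb hp.1 hq.1)
  · exact (add_le_add (mul_le_mul_right hxG _) (mul_le_mul_right hyG _)).trans_eq
      (hcomb hp.2 hq.2)

theorem exists_lagrange_multiplier [TopologicalSpace P] [CompactSpace P] {C G : P → ℝ≥0∞}
    (hC : LowerSemicontinuous C) (hG : LowerSemicontinuous G) (hCG : IsConvexlike C G)
    {r a : ℝ≥0} (hra : ∀ x, C x ≤ r → a < G x) :
    ∃ l : ℝ≥0, ∀ x, (a + l * r : ℝ≥0∞) ≤ G x + l * C x := by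
  have hnot : ((r : ℝ), (a : ℝ)) ∉ upperImage C G := by
    rintro ⟨-, x, hxC, hxG⟩
    rw [ENNReal.ofReal_coe_nnreal] at hxC hxG
    exact (hra x hxC).not_ge hxG
  obtain ⟨l, hl, hle⟩ := exists_pos_slope_of_notMem (convex_upperImage hCG)
    (isClosed_upperImage hC hG) (fun _ hp => hp.1) (isUpperSet_upperImage C G) hnot
  lift l to ℝ≥0 using hl.le
  refine ⟨l, fun x => ?_⟩
  -- Here `l ≠ 0` matters: the upper image does not see the points with `C x = ∞`.
  rcases eq_or_ne (C x) ∞ with hCx | hCx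
  · simp [hCx, ENNReal.mul_top (ENNReal.coe_ne_zero.2 (NNReal.coe_pos.1 hl).ne')]
  rcases eq_or_ne (G x) ∞ with hGx | hGx
  · simp [hGx]
  have hx := hle ((C x).toReal, (G x).toReal) ⟨⟨ENNReal.toReal_nonneg, ENNReal.toReal_nonneg⟩, x,
    (ENNReal.ofReal_toReal hCx).ge, (ENNReal.ofReal_toReal hGx).ge⟩
  lift C x to ℝ≥0 using hCx with cx
  lift G x to ℝ≥0 using hGx with gx
  exact_mod_cast hx

end Multiplier

/-! ### The extended integral -/

section ExtendedIntegral

variable {X Y : Type*} [MeasurableSpace X] [MeasurableSpace Y] {m : Measure X}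

lemma extInt_mono {g h : X → ℝ} (hgh : ∀ x, g x ≤ h x) : extInt m g ≤ extInt m h :=
  EReal.sub_le_sub
    (EReal.coe_ennreal_le_coe_ennreal_iff.2
      (lintegral_mono fun x => ENNReal.ofReal_le_ofReal (hgh x)))
    (EReal.coe_ennreal_le_coe_ennreal_iff.2
      (lintegral_mono fun x => ENNReal.ofReal_le_ofReal (neg_le_neg (hgh x))))

lemma extInt_map {T : X → Y} (hT : Measurable T) {g : Y → ℝ} (hg : Measurable g) :
    extInt (m.map T) g = extInt m fun x => g (T x) := by
  rw [extInt, extInt, lintegral_map hg.ennreal_ofReal hT, lintegral_map (by fun_prop) hT]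

lemma extInt_coe_nnreal (h : X → ℝ≥0) :
    extInt m (fun x => (h x : ℝ)) = ((∫⁻ x, h x ∂m : ℝ≥0∞) : EReal) := by
  have hneg (x : X) : ENNReal.ofReal (-(h x : ℝ)) = 0 :=
    ENNReal.ofReal_of_nonpos (neg_nonpos.2 (h x).2)
  simp only [extInt, hneg, ENNReal.ofReal_coe_nnreal, lintegral_zero, EReal.coe_ennreal_zero,
    sub_zero]

lemma lintegral_ofReal_neg_ne_top [IsFiniteMeasure m] {g : X → ℝ} (hg : BddBelow (Set.range g)) :
    ∫⁻ x, ENNReal.ofReal (-g x) ∂m ≠ ∞ := by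
  obtain ⟨b, hb⟩ := hg
  exact ((lintegral_mono fun x => ENNReal.ofReal_le_ofReal (neg_le_neg (hb ⟨x, rfl⟩))).trans_lt
    (lintegral_const_lt_top ENNReal.ofReal_ne_top)).ne

lemma coe_sub_coe_eq_of_add_eq {p q p' q' h : ℝ≥0∞} (hq : q ≠ ∞) (hq' : q' ≠ ∞)
    (heq : p' + q = p + h + q') : (p' : EReal) - q' = p - q + h := by
  lift q to ℝ≥0 using hq
  lift q' to ℝ≥0 using hq'
  have hcancel (n : ℝ≥0) : (n : EReal) + -(n : EReal) = 0 := EReal.sub_self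
    (EReal.coe_ne_top n) (EReal.coe_ne_bot n)
  have heq' : (p' : EReal) + q = p + h + q' := by exact_mod_cast congrArg ENNReal.toEReal heq
  calc (p' : EReal) - q' = p' + (q + -q) + -q' := by rw [hcancel, add_zero, sub_eq_add_neg]
    _ = p' + q + -q + -q' := by rw [add_assoc (p' : EReal) q]
    _ = p + -q + h + (q' + -q') := by rw [heq']; ac_rfl
    _ = p - q + h := by rw [hcancel, add_zero, sub_eq_add_neg]

lemma extInt_add_coe_nnreal {g : X → ℝ} (hg : Measurable g) {h : X → ℝ≥0} (hh : Measurable h)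
    (hneg : ∫⁻ x, ENNReal.ofReal (-g x) ∂m ≠ ∞) :
    extInt m (fun x => g x + h x) = extInt m g + ((∫⁻ x, h x ∂m : ℝ≥0∞) : EReal) := by
  have hneg' : ∫⁻ x, ENNReal.ofReal (-(g x + h x)) ∂m ≠ ∞ :=
    ne_top_of_le_ne_top hneg
      (lintegral_mono fun x => ENNReal.ofReal_le_ofReal (by linarith [(h x).2]))
  have hparts (x : X) : ENNReal.ofReal (g x + h x) + ENNReal.ofReal (-g x) =
      ENNReal.ofReal (g x) + h x + ENNReal.ofReal (-(g x + h x)) := by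
    have hreal : (g x + h x).toNNReal + (-g x).toNNReal =
        (g x).toNNReal + h x + (-(g x + h x)).toNNReal := by
      rw [← NNReal.coe_inj]
      push_cast [Real.coe_toNNReal']
      linarith [max_zero_sub_max_neg_zero_eq_self (g x),
        max_zero_sub_max_neg_zero_eq_self (g x + h x)]
    simp only [ENNReal.ofReal, ← ENNReal.coe_add, hreal]
  refine coe_sub_coe_eq_of_add_eq hneg hneg' ?_
  rw [← lintegral_add_left (by fun_prop), ← lintegral_add_left (by fun_prop),
    ← lintegral_add_left (by fun_prop), lintegral_congr hparts]

lemma extInt_eq_lintegral_sub [IsProbabilityMeasure m] {f : X → ℝ} (hf : Measurable f)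
    {g : X → ℝ≥0} {B : ℝ≥0} (hg : ∀ x, (g x : ℝ) = f x + B) :
    extInt m f = ((∫⁻ x, g x ∂m : ℝ≥0∞) : EReal) - (B : ℝ) := by
  have hf_bdd : BddBelow (Set.range f) :=
    ⟨-B, Set.forall_mem_range.2 fun x => by linarith [hg x, (g x).2]⟩
  have hadd := extInt_add_coe_nnreal hf (measurable_const (a := B))
    (lintegral_ofReal_neg_ne_top (m := m) hf_bdd)
  simp only [← hg, extInt_coe_nnreal, lintegral_const, measure_univ, mul_one] at hadd
  rw [hadd, EReal.coe_nnreal_eq_coe_real, EReal.add_sub_cancel_right]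

end ExtendedIntegral

/-! ### Lower semicontinuity and mixtures on spaces of probability measures -/

section ProbabilityMeasure

variable {Ω : Type*} [MeasurableSpace Ω]

theorem lowerSemicontinuous_lintegral [TopologicalSpace Ω]
    [TopologicalSpace.PseudoMetrizableSpace Ω] [TopologicalSpace.SeparableSpace Ω]
    [BorelSpace Ω] {g : Ω → ℝ≥0} (hg : LowerSemicontinuous g) :
    LowerSemicontinuous fun m : ProbabilityMeasure Ω => ∫⁻ x, g x ∂(m : Measure Ω) := by
  rw [lowerSemicontinuous_iff_le_liminf]
  intro m
  have hlayer (m' : ProbabilityMeasure Ω) : ∫⁻ x, g x ∂(m' : Measure Ω) =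
      ∫⁻ t in Set.Ioi (0 : ℝ), (m' : Measure Ω) {x | t < g x} := by
    simpa only [ENNReal.ofReal_coe_nnreal] using
      lintegral_eq_lintegral_meas_lt (m' : Measure Ω)
        (Eventually.of_forall fun x => (g x).coe_nonneg) hg.measurable.coe_nnreal_real.aemeasurable
  have hopen (t : ℝ) : IsOpen {x | t < g x} :=
    (NNReal.continuous_coe.comp_lowerSemicontinuous hg NNReal.coe_mono).isOpen_preimage t
  simp only [hlayer]
  calc ∫⁻ t in Set.Ioi (0 : ℝ), (m : Measure Ω) {x | t < g x}
      ≤ ∫⁻ t in Set.Ioi (0 : ℝ),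
          (𝓝 m).liminf fun m' : ProbabilityMeasure Ω => (m' : Measure Ω) {x | t < g x} :=
        lintegral_mono fun t =>
          ProbabilityMeasure.le_liminf_measure_open_of_tendsto tendsto_id (hopen t)
    _ ≤ _ := lintegral_liminf_le fun m' => Antitone.measurable fun s t hst =>
        measure_mono fun x hx => lt_of_le_of_lt hst hx

/-- The mixture `s π + t ρ` of two probability measures, for weights with `s + t = 1`. -/
noncomputable def mixture {s t : ℝ≥0} (hst : s + t = 1) (π ρ : ProbabilityMeasure Ω) :
    ProbabilityMeasure Ω :=
  ⟨(s : ℝ≥0∞) • (π : Measure Ω) + (t : ℝ≥0∞) • (ρ : Measure Ω),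
    ⟨by simp [← ENNReal.coe_add, hst]⟩⟩

lemma lintegral_mixture {s t : ℝ≥0} (hst : s + t = 1) (π ρ : ProbabilityMeasure Ω)
    (g : Ω → ℝ≥0∞) : ∫⁻ x, g x ∂(mixture hst π ρ : Measure Ω) =
      s * ∫⁻ x, g x ∂(π : Measure Ω) + t * ∫⁻ x, g x ∂(ρ : Measure Ω) := by
  rw [mixture, ProbabilityMeasure.coe_mk, lintegral_add_measure, lintegral_smul_measure,
    lintegral_smul_measure, smul_eq_mul, smul_eq_mul]

end ProbabilityMeasure

/-! ### Transport plans -/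

section Plans

variable {S : Type*} [MeasurableSpace S] {μ : ProbabilityMeasure S}

lemma mem_plansFrom {π : ProbabilityMeasure (S × S)} :
    π ∈ plansFrom μ ↔ (π : Measure (S × S)).map Prod.fst = μ := by
  rw [← ProbabilityMeasure.toMeasure_map π measurable_fst.aemeasurable]
  exact (and_iff_left trivial).trans Subtype.ext_iff

lemma deterministicPlan_mem_plansFrom {T : S → S} (hT : Measurable T) :
    deterministicPlan μ T hT ∈ plansFrom μ := by
  rw [mem_plansFrom, deterministicPlan, ProbabilityMeasure.toMeasure_map,
    Measure.map_map measurable_fst (by fun_prop)]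
  exact Measure.map_id

lemma mixture_mem_plansFrom {π ρ : ProbabilityMeasure (S × S)} (hπ : π ∈ plansFrom μ)
    (hρ : ρ ∈ plansFrom μ) {s t : ℝ≥0} (hst : s + t = 1) : mixture hst π ρ ∈ plansFrom μ := by
  rw [mem_plansFrom] at hπ hρ ⊢
  rw [mixture, ProbabilityMeasure.coe_mk, Measure.map_add _ _ measurable_fst, Measure.map_smul,
    Measure.map_smul, hπ, hρ, ← add_smul, ← ENNReal.coe_add, hst, ENNReal.coe_one, one_smul]

lemma isConvexlike_planCost (μ : ProbabilityMeasure S) (c g : S × S → ℝ≥0) :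
    IsConvexlike (fun π : plansFrom μ => planCost c π) (fun π : plansFrom μ => planCost g π) :=
  fun π ρ _ _ hst => ⟨⟨mixture hst π ρ, mixture_mem_plansFrom π.2 ρ.2 hst⟩,
    (lintegral_mixture hst _ _ _).le, (lintegral_mixture hst _ _ _).le⟩

lemma prod_mem_transportPlans (μ ν : ProbabilityMeasure S) :
    μ.prod ν ∈ transportPlans {μ} {ν} :=
  ⟨μ.map_fst_prod ν, μ.map_snd_prod ν⟩

variable [TopologicalSpace S] [PolishSpace S] [BorelSpace S]

lemma isClosed_transportPlans {P Q : Set (ProbabilityMeasure S)} (hP : IsClosed P)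
    (hQ : IsClosed Q) : IsClosed (transportPlans P Q) :=
  (hP.preimage (ProbabilityMeasure.continuous_map continuous_fst)).inter
    (hQ.preimage (ProbabilityMeasure.continuous_map continuous_snd))

variable [CompactSpace S]

instance compactSpace_plansFrom (μ : ProbabilityMeasure S) : CompactSpace (plansFrom μ) :=
  isCompact_iff_compactSpace.1 (isClosed_transportPlans isClosed_singleton isClosed_univ).isCompact

variable {c : S × S → ℝ≥0}

lemma exists_planCost_eq_transportCost (hc : LowerSemicontinuous c) (μ ν : ProbabilityMeasure S) :
    ∃ π ∈ transportPlans {μ} {ν}, planCost c π = transportCost c μ ν := by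
  obtain ⟨π, hπ, hmin⟩ := (lowerSemicontinuous_lintegral hc).lowerSemicontinuousOn _
    |>.exists_isMinOn ⟨_, prod_mem_transportPlans μ ν⟩
      (isClosed_transportPlans isClosed_singleton isClosed_singleton).isCompact
  exact ⟨π, hπ, le_antisymm (le_iInf₂ fun _ hρ => hmin hρ) (iInf₂_le π hπ)⟩

lemma uncertaintySet_eq_image (hc : LowerSemicontinuous c) (μ : ProbabilityMeasure S) (r : ℝ) :
    uncertaintySet c μ r =
      (fun π => π.map measurable_snd.aemeasurable) ''
        {π ∈ plansFrom μ | planCost c π ≤ ENNReal.ofReal r} := by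
  ext ν
  constructor
  · intro hν
    obtain ⟨π, hπ, hcost⟩ := exists_planCost_eq_transportCost hc μ ν
    exact ⟨π, ⟨⟨hπ.1, trivial⟩, hcost.trans_le hν⟩, hπ.2⟩
  · rintro ⟨π, ⟨hπ, hcost⟩, rfl⟩
    have hle : transportCost c μ (π.map measurable_snd.aemeasurable) ≤ planCost c π :=
      iInf₂_le π ⟨hπ.1, rfl⟩
    exact hle.trans hcost

theorem primalValue_eq_primalPlanValue {f : S → ℝ} (hf : Measurable f)
    (hc : LowerSemicontinuous c) (μ : ProbabilityMeasure S) (r : ℝ) :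
    primalValue f c μ r = primalPlanValue f c μ r := by
  rw [primalValue, primalPlanValue, uncertaintySet_eq_image hc, iInf_image]
  simp only [ProbabilityMeasure.toMeasure_map, extInt_map measurable_snd hf]

end Plans

/-! ### The inner minimisation problem -/

section InnerProblem

variable {S : Type*} {f : S → ℝ} {c : S × S → ℝ≥0} {l : ℝ≥0}

lemma IsMinimiserSelection.phi_eq {T : S → S} (hT : IsMinimiserSelection f c l T) (x : S) :
    phi f c l x = f (T x) + l * c (x, T x) :=
  IsLeast.csInf_eq ⟨⟨T x, rfl⟩, Set.forall_mem_range.2 (hT x)⟩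

section Topological

variable [TopologicalSpace S]

lemma lowerSemicontinuous_integrand (hf : LowerSemicontinuous f) (hc : LowerSemicontinuous c)
    (l : ℝ≥0) : LowerSemicontinuous fun p : S × S => f p.2 + l * c p :=
  (hf.comp continuous_snd).add
    ((continuous_const.mul NNReal.continuous_coe).comp_lowerSemicontinuous hc fun _ _ hst =>
      mul_le_mul_of_nonneg_left (NNReal.coe_le_coe.2 hst) l.2)

variable [CompactSpace S] [Nonempty S]

lemma isLeast_phi (hf : LowerSemicontinuous f) (hc : LowerSemicontinuous c) (l : ℝ≥0) (x : S) :
    IsLeast (Set.range fun y => f y + l * c (x, y)) (phi f c l x) :=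
  isLeast_iInf_of_lowerSemicontinuous
    ((lowerSemicontinuous_integrand hf hc l).comp (Continuous.prodMk_right x))

lemma lowerSemicontinuous_phi (hf : LowerSemicontinuous f) (hc : LowerSemicontinuous c)
    (l : ℝ≥0) : LowerSemicontinuous (phi f c l) :=
  lowerSemicontinuous_iInf_snd (lowerSemicontinuous_integrand hf hc l)

lemma exists_measurable_isMinimiserSelection [TopologicalSpace.MetrizableSpace S]
    [MeasurableSpace S] [BorelSpace S] (hf : LowerSemicontinuous f) (hc : LowerSemicontinuous c)
    (l : ℝ≥0) : ∃ T : S → S, Measurable T ∧ IsMinimiserSelection f c l T :=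
  exists_measurable_forall_le (lowerSemicontinuous_integrand hf hc l)

end Topological

section Measurable

variable [MeasurableSpace S] {μ : ProbabilityMeasure S} {π : ProbabilityMeasure (S × S)}

lemma extInt_integrand (hf : Measurable f) (hf_bdd : BddBelow (Set.range f)) (hc : Measurable c)
    (π : ProbabilityMeasure (S × S)) (l : ℝ≥0) :
    extInt (π : Measure (S × S)) (fun p => f p.2 + l * c p) =
      extInt (π : Measure (S × S)) (fun p => f p.2) + ((l * planCost c π : ℝ≥0∞) : EReal) := by
  have hneg : ∫⁻ p : S × S, ENNReal.ofReal (-f p.2) ∂(π : Measure (S × S)) ≠ ∞ :=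
    lintegral_ofReal_neg_ne_top (hf_bdd.mono (Set.range_comp_subset_range Prod.snd f))
  rw [planCost, ← lintegral_const_mul _ hc.coe_nnreal_ennreal]
  exact_mod_cast extInt_add_coe_nnreal (hf.comp measurable_snd) (hc.const_mul l) hneg

lemma lagrangian_le_of_planCost_le (hf : Measurable f) (hf_bdd : BddBelow (Set.range f))
    (hc : Measurable c) {r : ℝ} (hr : 0 ≤ r) (hπ : planCost c π ≤ ENNReal.ofReal r) (l : ℝ≥0) :
    lagrangian f c r π l ≤ extInt (π : Measure (S × S)) fun p => f p.2 := by
  lift r to ℝ≥0 using hr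
  rw [ENNReal.ofReal_coe_nnreal] at hπ
  have hcost : ((l * planCost c π : ℝ≥0∞) : EReal) ≤ ((l * r : ℝ) : EReal) := by
    rw [← NNReal.coe_mul, ← EReal.coe_nnreal_eq_coe_real, ENNReal.coe_mul]
    exact EReal.coe_ennreal_le_coe_ennreal_iff.2 (mul_le_mul_right hπ _)
  rw [lagrangian, extInt_integrand hf hf_bdd hc]
  exact EReal.sub_le_of_le_add (add_le_add_right hcost _)

lemma lagrangian_deterministicPlan (hf : Measurable f) (hc : Measurable c) (r : ℝ) {T : S → S}
    (hT : Measurable T) (hsel : IsMinimiserSelection f c l T) :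
    lagrangian f c r (deterministicPlan μ T hT) l =
      extInt (μ : Measure S) (phi f c l) - ((l * r : ℝ) : EReal) := by
  rw [lagrangian, deterministicPlan, ProbabilityMeasure.toMeasure_map,
    extInt_map (by fun_prop) (by fun_prop), funext hsel.phi_eq]

lemma extInt_phi_sub_le_lagrangian (hphi : Measurable (phi f c l))
    (hphi_le : ∀ x y, phi f c l x ≤ f y + l * c (x, y)) (r : ℝ)
    (hπ : π ∈ plansFrom μ) :
    extInt (μ : Measure S) (phi f c l) - ((l * r : ℝ) : EReal) ≤ lagrangian f c r π l := by
  rw [← mem_plansFrom.1 hπ, extInt_map measurable_fst hphi, lagrangian]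
  exact EReal.sub_le_sub (extInt_mono fun p => hphi_le p.1 p.2) le_rfl

end Measurable

end InnerProblem

/-! ### Duality -/

section Duality

variable {S : Type*} [TopologicalSpace S] [PolishSpace S] [CompactSpace S] [MeasurableSpace S]
  [BorelSpace S] {f : S → ℝ} {c : S × S → ℝ≥0} {r : ℝ}

theorem dualValue_le_primalPlanValue (hf : LowerSemicontinuous f) (hc : LowerSemicontinuous c)
    (μ : ProbabilityMeasure S) (hr : 0 ≤ r) : dualValue f c μ r ≤ primalPlanValue f c μ r := by
  have : Nonempty S := μ.nonempty
  exact iSup_le fun l => le_iInf₂ fun π hπ =>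
    (extInt_phi_sub_le_lagrangian (lowerSemicontinuous_phi hf hc l).measurable
      (fun x y => (isLeast_phi hf hc l x).2 ⟨y, rfl⟩) r hπ.1).trans
    (lagrangian_le_of_planCost_le hf.measurable (isLeast_iInf_of_lowerSemicontinuous hf).bddBelow
      hc.measurable hr hπ.2 l)

theorem exists_forall_le_lagrangian (hf : LowerSemicontinuous f) (hc : LowerSemicontinuous c)
    {μ : ProbabilityMeasure S} (hr : 0 ≤ r) {a : ℝ} (ha : a < primalPlanValue f c μ r) :
    ∃ l : ℝ≥0, ∀ π ∈ plansFrom μ, (a : EReal) ≤ lagrangian f c r π l := by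
  have : Nonempty S := μ.nonempty
  have hf_bdd := (isLeast_iInf_of_lowerSemicontinuous hf).bddBelow
  obtain ⟨B, haB, g, hg, hgf⟩ := exists_coe_eq_add hf hf_bdd a
  have hG (π : ProbabilityMeasure (S × S)) : extInt (π : Measure (S × S)) (fun p => f p.2) =
      (planCost (g ∘ Prod.snd) π : EReal) - (B : ℝ) :=
    extInt_eq_lintegral_sub (hf.measurable.comp measurable_snd) fun p => hgf p.2
  lift r to ℝ≥0 using hr
  obtain ⟨a', ha'⟩ : ∃ a' : ℝ≥0, (a' : ℝ) = a + B := ⟨⟨a + B, by linarith⟩, rfl⟩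
  have hlsc {h : S × S → ℝ≥0} (hh : LowerSemicontinuous h) :
      LowerSemicontinuous fun π : plansFrom μ => planCost h π :=
    (lowerSemicontinuous_lintegral hh).comp continuous_subtype_val
  have hlt (π : plansFrom μ) (hπ : planCost c π ≤ r) : (a' : ℝ≥0∞) < planCost (g ∘ Prod.snd) π := by
    have hπa := ha.trans_le (iInf₂_le π.1 ⟨π.2, by rwa [ENNReal.ofReal_coe_nnreal]⟩)
    rw [hG, EReal.lt_sub_iff_add_lt (.inl (EReal.coe_ne_bot _)) (.inl (EReal.coe_ne_top _)),
      ← EReal.coe_add, ← ha', ← EReal.coe_nnreal_eq_coe_real] at hπa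
    exact EReal.coe_ennreal_lt_coe_ennreal_iff.1 hπa
  obtain ⟨l, hl⟩ := exists_lagrange_multiplier (hlsc hc) (hlsc (hg.comp continuous_snd))
    (isConvexlike_planCost μ c (g ∘ Prod.snd)) hlt
  refine ⟨l, fun π hπ => ?_⟩
  have hle := EReal.coe_ennreal_le_coe_ennreal_iff.2 (hl ⟨π, hπ⟩)
  rw [EReal.coe_ennreal_add, EReal.coe_ennreal_add, ← ENNReal.coe_mul,
    EReal.coe_nnreal_eq_coe_real, EReal.coe_nnreal_eq_coe_real, ha', NNReal.coe_mul] at hle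
  rw [lagrangian, extInt_integrand hf.measurable hf_bdd hc.measurable, hG,
    EReal.le_sub_iff_add_le (.inl (EReal.coe_ne_bot _)) (.inl (EReal.coe_ne_top _)),
    sub_eq_add_neg, add_right_comm, ← sub_eq_add_neg,
    EReal.le_sub_iff_add_le (.inl (EReal.coe_ne_bot _)) (.inl (EReal.coe_ne_top _)),
    add_right_comm, ← EReal.coe_add]
  exact hle

theorem primalPlanValue_le_dualValue (hf : LowerSemicontinuous f) (hc : LowerSemicontinuous c)
    (μ : ProbabilityMeasure S) (hr : 0 ≤ r) : primalPlanValue f c μ r ≤ dualValue f c μ r := by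
  have : Nonempty S := μ.nonempty
  refine EReal.ge_of_forall_gt_iff_ge.1 fun a ha => ?_
  obtain ⟨l, hl⟩ := exists_forall_le_lagrangian hf hc hr ha
  obtain ⟨T, hT, hsel⟩ := exists_measurable_isMinimiserSelection hf hc l
  calc (a : EReal) ≤ lagrangian f c r (deterministicPlan μ T hT) l :=
        hl _ (deterministicPlan_mem_plansFrom hT)
    _ = extInt (μ : Measure S) (phi f c l) - ((l * r : ℝ) : EReal) :=
        lagrangian_deterministicPlan hf.measurable hc.measurable r hT hsel
    _ ≤ dualValue f c μ r := le_iSup (fun l : ℝ≥0 => extInt (μ : Measure S) (phi f c l) -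
        ((l * r : ℝ) : EReal)) l

end Duality

end OTDuality

open OTDuality in
theorem mainTheorem1 {S : Type*} [TopologicalSpace S] [PolishSpace S] [CompactSpace S]
    [MeasurableSpace S] [BorelSpace S]
    (f : S → ℝ) (hf : LowerSemicontinuous f)
    (c : S × S → ℝ≥0) (hc : LowerSemicontinuous c)
    (μ : ProbabilityMeasure S) (r : ℝ) (hr : 0 < r) :
    -- the two forms of the primal problem and the dual problem have the same value
    (primalValue f c μ r = dualValue f c μ r ∧ primalPlanValue f c μ r = dualValue f c μ r) ∧
    -- the infimum defining `φ_l(x)` is a minimum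
    (∀ (l : ℝ≥0) (x : S), IsLeast (Set.range fun y => f y + l * c (x, y)) (phi f c l x)) ∧
    -- measurable selections of minimisers exist, and each of them induces a deterministic
    -- coupling that solves the inner minimisation problem
    (∀ l : ℝ≥0,
      (∃ T : S → S, Measurable T ∧ IsMinimiserSelection f c l T) ∧
      ∀ (T : S → S) (hT : Measurable T), IsMinimiserSelection f c l T →
        deterministicPlan μ T hT ∈ plansFrom μ ∧
        (∀ π ∈ plansFrom μ,
          lagrangian f c r (deterministicPlan μ T hT) l ≤ lagrangian f c r π l) ∧
        lagrangian f c r (deterministicPlan μ T hT) l =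
          extInt (μ : Measure S) (phi f c l) - ((l * r : ℝ) : EReal)) := by
  have : Nonempty S := μ.nonempty
  have hforms := primalValue_eq_primalPlanValue hf.measurable hc μ r
  have hduality : primalPlanValue f c μ r = dualValue f c μ r :=
    le_antisymm (primalPlanValue_le_dualValue hf hc μ hr.le)
      (dualValue_le_primalPlanValue hf hc μ hr.le)
  have hplan {l : ℝ≥0} {T : S → S} (hT : Measurable T) (hsel : IsMinimiserSelection f c l T) :=
    lagrangian_deterministicPlan (μ := μ) hf.measurable hc.measurable r hT hsel
  refine ⟨⟨hforms.trans hduality, hduality⟩, isLeast_phi hf hc, fun l =>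
    ⟨exists_measurable_isMinimiserSelection hf hc l, fun T hT hsel =>
      ⟨deterministicPlan_mem_plansFrom hT, fun π hπ => ?_, hplan hT hsel⟩⟩⟩
  exact (hplan hT hsel).trans_le (extInt_phi_sub_le_lagrangian
    (lowerSemicontinuous_phi hf hc l).measurable (fun x y => (isLeast_phi hf hc l x).2 ⟨y, rfl⟩)
    r hπ)
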